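/- Consider $N$ agents $v_1,\dots,v_N$ with states $x_i(t)\in\mathbb R$, and for each $t\ge 0$ a signed weight matrix $A(t)=(a_{ij}(t))\in\mathbb R^{N\times N}$. Let $\mathbb G(t)$ be the directed signed graph without self-loops on $\mathcal V=\{v_1,\dots,v_N\}$ that has an edge $(v_j,v_i)$, $j\ne i$, if and only if $a_{ij}(t)\neq 0$, the sign of the edge being the sign of $a_{ij}(t)$. Let $L(t)$ be the signed Laplacian, $l_{ii}(t)=\sum_{j\ne i}|a_{ij}(t)|$ and $l_{ij}(t)=-a_{ij}(t)$ for $j\neq i$. Let $0=t_0<t_1<t_2<\cdots$ be times such that $A(t)=A(t_i)$ for $t\in[t_i,t_{i+1})$, and such that every dwell time $t_{i+1}-t_i$ lies in the set $\mathcal T$ of all finite nonempty sums of elements of a finite set $\tau$ of positive numbers (the smallest set containing $\tau$ that is closed under addition and under multiplication by positive integers). Assume that there are constants $\gamma_1,\gamma_2>0$ such that $|a_{jk}(t_i)|\in[\gamma_1,\gamma_2]$ for all $i\ge0$ and all $j\neq k$ with $a_{jk}(t_i)\ne0$. Consider the system $$\dot x(t)=-L(t_i)\,x(t),\qquad t\in[t_i,t_{i+1}),\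 i=0,1,2,\dots,$$ with $x$ continuous on $[0,\infty)$. A root of a directed graph is a vertex with a directed path to every other vertex, and the root vertex set is the set of all roots; a spanning tree is a subgraph on all the vertices that is a directed tree (it has a root with no incoming edge, and every other vertex has exactly one incoming edge). The union of the graphs over a set of times has all edges that occur at some time in that set. Let $\mathcal V^s$ be the root vertex set of the union of the graphs $\mathbb G(t)$ over $[0,\infty)$. Assume that $\mathcal V^s$ is the disjoint union of two nonempty subsets such that in each graph $\mathbb G(t)$, $t\ge0$, all edges between the two subsets are negative and all edges within each subset are positive. Assume that there are indices $0=i_0<i_1<i_2<\cdots$ such that the intervals $[t_{i_k},t_{i_{k+1}})$, $k\ge0$, are uniformly bounded in length and, for every $k$, the union of the graphs over $[t_{i_k},t_{i_{k+1}})$ contains a spanning tree and has root vertex set $\mathcal V^s$. Then: 1. The agents in $\mathcal V^s$ polarize: for Lebesgue-almost every initial condition $x(0)\in\mathbb R^N$, $\lim_{t\to\infty}x_i(t)$ exists for every $v_i\in\mathcal V^s$, $|\lim_{t\to\infty} x_i(t)|=|\lim_{t\to\infty} x_j(t)|>0$ for all $v_i,v_j\in\mathcal V^s$, and $\lim_{t\to\infty}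 x_i(t)=-\lim_{t\to\infty} x_j(t)$ for some $v_i,v_j\in\mathcal V^s$ with $i\ne j$. 2. The states of the other agents finally lie in between the polarized values: for every solution there is $C\ge0$ such that $\lim_{t\to\infty}|x_i(t)|=C$ for all $v_i\in\mathcal V^s$ and, for every $v_j\notin\mathcal V^s$ and every $\varepsilon>0$, $x_j(t)\in[-C-\varepsilon,C+\varepsilon]$ for all sufficiently large $t$ (that is, $\limsup_{t\to\infty}|x_j(t)|\le C$). -/

import Mathlib

namespace SignedNetwork

open Filter Topology MeasureTheory

variable {V : Type*}

/-- The vertex `v` has a directed path to every other vertex of `G`. -/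
def IsRoot (G : Digraph V) (v : V) : Prop :=
  ∀ w, w ≠ v → Relation.TransGen G.Adj v w

/-- The root vertex set of `G`: the set of all its roots. -/
def rootSet (G : Digraph V) : Set V :=
  {v | IsRoot G v}

/-- A directed tree on the whole vertex set: a root reaching every other vertex, no edge entering
the root, and exactly one edge entering each other vertex. -/
def IsDirectedTree (T : Digraph V) : Prop :=
  ∃ r, IsRoot T r ∧ (∀ u, ¬ T.Adj u r) ∧ ∀ w, w ≠ r → ∃! u, T.Adj u w

/-- `G` has a subgraph, on all vertices of `G`, that is a directed tree. -/
def ContainsSpanningTree (G : Digraph V) : Prop :=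
  ∃ T : Digraph V, T ≤ G ∧ IsDirectedTree T

/-- The graph of a signed weight matrix: the edge `(j, i)` from `j` to `i` is present iff agent `i`
puts a nonzero weight `A i j` on agent `j ≠ i`; its sign is the sign of `A i j`.
There are no self-loops. -/
def graph (A : Matrix V V ℝ) : Digraph V where
  Adj j i := j ≠ i ∧ A i j ≠ 0

/-- The union of the graphs of `A s` over the times `s ∈ I`. -/
def unionGraph (A : ℝ → Matrix V V ℝ) (I : Set ℝ) : Digraph V :=
  ⨆ s ∈ I, graph (A s)

/-- All edges of the signed graph of `A` with both ends in `V₁` or both ends in `V₂` are positive,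
and all edges between `V₁` and `V₂` (in either direction) are negative. -/
def RespectsBipartition (A : Matrix V V ℝ) (V₁ V₂ : Set V) : Prop :=
  ∀ i j, (graph A).Adj j i →
    ((i ∈ V₁ ∧ j ∈ V₁ ∨ i ∈ V₂ ∧ j ∈ V₂) → 0 < A i j) ∧
    ((i ∈ V₁ ∧ j ∈ V₂ ∨ i ∈ V₂ ∧ j ∈ V₁) → A i j < 0)

/-- The signed Laplacian: `l i i = ∑_{j ≠ i} |a i j|` and `l i j = - a i j` for `j ≠ i`. -/
def signedLaplacian [Fintype V] [DecidableEq V] (A : Matrix V V ℝ) : Matrix V V ℝ :=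
  Matrix.of fun i j => if i = j then ∑ k ∈ Finset.univ.erase i, |A i k| else -A i j

/-- `x` is a solution on `[0, ∞)` of `x' = -L(tᵢ) x` on each `[tᵢ, tᵢ₊₁)`: it is continuous, and
satisfies the equation on each such interval (with the right derivative at `tᵢ`). -/
def IsSolution [Fintype V] [DecidableEq V] (A : ℝ → Matrix V V ℝ) (t : ℕ → ℝ)
    (x : ℝ → V → ℝ) : Prop :=
  ContinuousOn x (Set.Ici 0) ∧
    ∀ i, ∀ s ∈ Set.Ico (t i) (t (i + 1)),
      HasDerivWithinAt x (-((signedLaplacian (A (t i))).mulVec (x s)))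
        (Set.Ico (t i) (t (i + 1))) s

/-- The agents in `S` polarize: for Lebesgue-almost every initial condition, their states converge
to limits of equal nonzero absolute value, and two of them have opposite limits. -/
def PolarizesOn [Fintype V] [DecidableEq V] (A : ℝ → Matrix V V ℝ) (t : ℕ → ℝ)
    (S : Set V) : Prop :=
  ∀ᵐ x₀ : V → ℝ, ∀ x : ℝ → V → ℝ, IsSolution A t x → x 0 = x₀ →
    ∃ l : V → ℝ,
      (∀ i ∈ S, Tendsto (fun s => x s i) atTop (𝓝 (l i))) ∧
      (∀ i ∈ S, ∀ j ∈ S, |l i| = |l j| ∧ 0 < |l j|) ∧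
      ∃ i ∈ S, ∃ j ∈ S, i ≠ j ∧ l i = -l j

end SignedNetwork

/-! An edge into a root starts at a root, so no edge enters `Vs` from outside and the agents in `Vs`
evolve autonomously. The bipartition gives signs `σ i = ±1` for which `y = σ x` solves, on `Vs`, the
unsigned consensus equation with weights `|a_ij|` (`IsSignedFlow.gauge`). For that equation a
maximum principle holds. If some vertex lies below the maximum, a fixed fraction of the gap survives
each block and crosses every edge active in it, so after as many blocks as vertices the maximum has
dropped by a fixed fraction of the spread (`gap_spread`). Hence `y` tends to a common value `c`
(`exists_consensus`), and `x i → σ i * c`.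

For almost every start `c ≠ 0`: the initial conditions with a solution vanishing on `Vs` form a
linear subspace, which omits `σ` because `y` stays at least `1` from there; a proper subspace is
Lebesgue null.

The remaining agents need not be balanced. On the double cover `V × Bool`, with states `x` and `-x`
on the two sheets, the signed dynamics becomes unsigned consensus without any balance condition. The
fibres over `Vs` are asymptotically at most `C = |c|`, and `eventually_le_of_reach` carries this
bound to both sheets over every vertex. -/

namespace SignedNetwork

open Filter Topology MeasureTheory

/-! ### Unsigned consensus: maximum principle and propagation of gaps. -/

section Flow

variable {W : Type*}

/-- Dwell times are bounded below by `δ`, and nonzero weights are positive and lie in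
`[γ₁, γ₂]`. -/
structure IsRegular (t : ℕ → ℝ) (w : ℕ → W → W → ℝ) (δ γ₁ γ₂ : ℝ) : Prop where
  zero : t 0 = 0
  pos : 0 < δ
  dwell : ∀ i, t i + δ ≤ t (i + 1)
  lower_pos : 0 < γ₁
  upper_nonneg : 0 ≤ γ₂
  nonneg : ∀ i p q, 0 ≤ w i p q
  le : ∀ i p q, w i p q ≤ γ₂
  ge : ∀ i p q, w i p q ≠ 0 → γ₁ ≤ w i p q

/-- Grönwall: `exp (K * (s - a)) * f s` has right derivative at least `c * exp (K * (s - a)) ≥ c`.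
-/
lemma exp_mul_le_of_deriv_right {f f' : ℝ → ℝ} {a b K c : ℝ} (hK : 0 ≤ K) (hc : 0 ≤ c)
    (hab : a ≤ b) (hf : ContinuousOn f (Set.Icc a b))
    (hd : ∀ s ∈ Set.Ico a b, HasDerivWithinAt f (f' s) (Set.Ici s) s)
    (h : ∀ s ∈ Set.Ico a b, -K * f s + c ≤ f' s) :
    Real.exp (-K * (b - a)) * (f a + c * (b - a)) ≤ f b := by
  have hE : ∀ s, HasDerivAt (fun s => Real.exp (K * (s - a))) (Real.exp (K * (s - a)) * K) s := by
    intro s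
    have := (((hasDerivAt_id s).sub_const a).const_mul K).exp
    simpa using this
  have key : ∀ ⦃x⦄, x ∈ Set.Icc a b → f a + c * (x - a) ≤ Real.exp (K * (x - a)) * f x := by
    refine image_le_of_deriv_right_le_deriv_boundary (f' := fun _ => c)
      (B' := fun s => Real.exp (K * (s - a)) * K * f s + Real.exp (K * (s - a)) * f' s)
      (by fun_prop) ?_ (by simp) ?_ ?_ ?_
    · intro s _
      have := ((((hasDerivAt_id s).sub_const a).const_mul c).const_add (f a)).hasDerivWithinAt
        (s := Set.Ici s)
      simpa using this
    · exact ContinuousOn.mul (by fun_prop) hf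
    · intro s hs
      exact (hE s).hasDerivWithinAt.mul (hd s hs)
    · intro s hs
      have h1 : 1 ≤ Real.exp (K * (s - a)) :=
        Real.one_le_exp (mul_nonneg hK (sub_nonneg.2 hs.1))
      nlinarith [h s hs]
  have hb := key (Set.right_mem_Icc.2 hab)
  calc Real.exp (-K * (b - a)) * (f a + c * (b - a))
      ≤ Real.exp (-K * (b - a)) * (Real.exp (K * (b - a)) * f b) := by gcongr
    _ = f b := by rw [← mul_assoc, ← Real.exp_add]; simp

variable {t : ℕ → ℝ} {w : ℕ → W → W → ℝ} {y : ℝ → W → ℝ} {δ γ₁ γ₂ : ℝ}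

namespace IsRegular

lemma lt_succ (hr : IsRegular t w δ γ₁ γ₂) (i : ℕ) : t i < t (i + 1) := by
  linarith [hr.dwell i, hr.pos]

lemma strictMono (hr : IsRegular t w δ γ₁ γ₂) : StrictMono t := strictMono_nat_of_lt_succ hr.lt_succ

lemma time_nonneg (hr : IsRegular t w δ γ₁ γ₂) (i : ℕ) : 0 ≤ t i :=
  hr.zero ▸ hr.strictMono.monotone (Nat.zero_le i)

lemma exists_mem_Ico (hr : IsRegular t w δ γ₁ γ₂) {i : ℕ} {s : ℝ} (hs : t i ≤ s) :
    ∃ n ≥ i, s ∈ Set.Ico (t n) (t (n + 1)) := by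
  -- The lower bound on dwell times excludes accumulation of switching times.
  have hlow : ∀ n : ℕ, n * δ ≤ t n := by
    intro n
    induction n with
    | zero => simp [hr.zero]
    | succ n ih => push_cast; linarith [hr.dwell n]
  have hex : ∃ n, s < t n := by
    obtain ⟨n, hn⟩ := exists_nat_gt (s / δ)
    exact ⟨n, ((div_lt_iff₀ hr.pos).1 hn).trans_le (hlow n)⟩
  classical
  have hfind := Nat.find_spec hex
  have hi : i < Nat.find hex := hr.strictMono.lt_iff_lt.1 (hs.trans_lt hfind)
  obtain ⟨n, hn⟩ : ∃ n, Nat.find hex = n + 1 := ⟨Nat.find hex - 1, by omega⟩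
  refine ⟨n, by omega, ?_, hn ▸ hfind⟩
  exact not_lt.1 (Nat.find_min hex (by omega))

end IsRegular

/-- The fraction of a gap that survives a block of length at most `T` in a network with `n`
vertices, and is transmitted along every edge active in the block. -/
noncomputable def gapFactor (n : ℕ) (δ γ₁ γ₂ T : ℝ) : ℝ :=
  min (Real.exp (-(n * γ₂) * T))
    -- The three exponentials, from the outside in: the decay at the head after the edge's dwell
    -- interval, the decay there during that interval, and the earlier decay of the gap at the tail.
    (Real.exp (-(n * γ₂) * T) * (Real.exp (-(n * γ₂) * T) *
      (γ₁ * Real.exp (-(n * γ₂) * T) * δ)))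

lemma IsRegular.gapFactor_pos (hr : IsRegular t w δ γ₁ γ₂) (n : ℕ) (T : ℝ) :
    0 < gapFactor n δ γ₁ γ₂ T := by
  have := hr.pos
  have := hr.lower_pos
  unfold gapFactor
  positivity

variable [Fintype W]

/-- A solution of the unsigned consensus dynamics `y_p' = ∑ q, w p q (y_q - y_p)` with weights
`w i` on `[t i, t (i + 1))`. -/
structure IsConsensusFlow (t : ℕ → ℝ) (w : ℕ → W → W → ℝ) (y : ℝ → W → ℝ) : Prop where
  cont : ∀ p, ContinuousOn (fun s => y s p) (Set.Ici 0)
  deriv : ∀ i, ∀ s ∈ Set.Ico (t i) (t (i + 1)), ∀ p,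
    HasDerivWithinAt (fun s => y s p) (∑ q, w i p q * (y s q - y s p)) (Set.Ici s) s

namespace IsConsensusFlow

lemma neg (hy : IsConsensusFlow t w y) : IsConsensusFlow t w (fun s p => -y s p) where
  cont p := (hy.cont p).neg
  deriv i s hs p := by
    refine (hy.deriv i s hs p).neg.congr_deriv ?_
    rw [← Finset.sum_neg_distrib]
    exact Finset.sum_congr rfl fun q _ => by ring

lemma continuousOn_dwell (hy : IsConsensusFlow t w y) (hr : IsRegular t w δ γ₁ γ₂) (i : ℕ)
    (s : ℝ) (p : W) : ContinuousOn (fun s => y s p) (Set.Icc (t i) s) :=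
  (hy.cont p).mono fun _ hx => (hr.time_nonneg i).trans hx.1

/-- Maximum principle by continuous induction against a barrier of slope `ε`: a state touching the
barrier is maximal, so its derivative is at most `0 < ε`. Then `ε` tends to `0`. -/
lemma le_of_dwell (hy : IsConsensusFlow t w y) (hr : IsRegular t w δ γ₁ γ₂) {i : ℕ} {M : ℝ}
    (hM : ∀ p, y (t i) p ≤ M) {s : ℝ} (hs : s ∈ Set.Icc (t i) (t (i + 1))) (p : W) :
    y s p ≤ M := by
  have main : ∀ ε > 0, ∀ s ∈ Set.Icc (t i) (t (i + 1)), ∀ p, y s p ≤ M + ε * (1 + (s - t i)) := by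
    intro ε hε
    have hcl : IsClosed ({s | ∀ p, y s p ≤ M + ε * (1 + (s - t i))} ∩
        Set.Icc (t i) (t (i + 1))) := by
      have : ({s | ∀ p, y s p ≤ M + ε * (1 + (s - t i))} ∩ Set.Icc (t i) (t (i + 1))) =
          Set.Icc (t i) (t (i + 1)) ∩
            ⋂ p, {s ∈ Set.Icc (t i) (t (i + 1)) | y s p ≤ M + ε * (1 + (s - t i))} := by
        ext s
        simp only [Set.mem_inter_iff, Set.mem_ofPred_eq, Set.mem_iInter]
        exact ⟨fun h => ⟨h.2, fun p => ⟨h.2, h.1 p⟩⟩, fun h => ⟨fun p => (h.2 p).2, h.1⟩⟩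
      rw [this]
      exact isClosed_Icc.inter (isClosed_iInter fun p =>
        isClosed_Icc.isClosed_le (hy.continuousOn_dwell hr i _ p) (by fun_prop))
    refine hcl.Icc_subset_of_forall_exists_gt ?_ ?_
    · intro p
      nlinarith [hM p]
    · rintro x ⟨hx, hxI⟩ z hz
      have hev : ∀ p, ∀ᶠ s in 𝓝[>] x, y s p ≤ M + ε * (1 + (s - t i)) := by
        intro p
        have hd : HasDerivWithinAt (fun s => M + ε * (1 + (s - t i)) - y s p)
            (ε - ∑ q, w i p q * (y x q - y x p)) (Set.Ici x) x := by
          have h1 : HasDerivAt (fun s => M + ε * (1 + (s - t i))) ε x := by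
            have := ((((hasDerivAt_id x).sub_const (t i)).const_add 1).const_mul ε).const_add M
            simpa using this
          exact h1.hasDerivWithinAt.sub (hy.deriv i x hxI p)
        rcases (hx p).lt_or_eq with hlt | heq
        · have := (hd.continuousWithinAt.mono Set.Ioi_subset_Ici_self).eventually
            (lt_mem_nhds (sub_pos.2 hlt))
          filter_upwards [this] with s hs
          linarith
        · have hpos : 0 < ε - ∑ q, w i p q * (y x q - y x p) := by
            have : ∑ q, w i p q * (y x q - y x p) ≤ 0 :=
              Finset.sum_nonpos fun q _ =>
                mul_nonpos_of_nonneg_of_nonpos (hr.nonneg i p q) (by linarith [hx q])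
            linarith
          have hs := (hasDerivWithinAt_iff_tendsto_slope' (by simp)).1
            (hd.mono Set.Ioi_subset_Ici_self)
          filter_upwards [hs.eventually (lt_mem_nhds hpos), self_mem_nhdsWithin] with s hs hxs
          rw [slope_def_field, heq, sub_self, sub_zero] at hs
          have := (div_pos_iff_of_pos_right (sub_pos.2 hxs)).1 hs
          linarith
      obtain ⟨s, hs1, hs2⟩ := ((eventually_all.2 hev).and (Ioc_mem_nhdsGT hz)).exists
      exact ⟨s, hs1, hs2⟩
  refine le_of_forall_pos_le_add fun ε hε => ?_
  have hL : 0 < 1 + (s - t i) := by linarith [hs.1]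
  have := main (ε / (1 + (s - t i))) (div_pos hε hL) s hs p
  rwa [div_mul_cancel₀ _ hL.ne'] at this

lemma le_of_le (hy : IsConsensusFlow t w y) (hr : IsRegular t w δ γ₁ γ₂) {i : ℕ} {M : ℝ}
    (hM : ∀ p, y (t i) p ≤ M) {s : ℝ} (hs : t i ≤ s) (p : W) : y s p ≤ M := by
  have hstep : ∀ n ≥ i, ∀ p, y (t n) p ≤ M := by
    intro n hn
    induction n, hn using Nat.le_induction with
    | base => exact hM
    | succ n _ ih => exact hy.le_of_dwell hr ih (Set.right_mem_Icc.2 (hr.lt_succ n).le)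
  obtain ⟨n, hn, hsn⟩ := hr.exists_mem_Ico hs
  exact hy.le_of_dwell hr (hstep n hn) ⟨hsn.1, hsn.2.le⟩ p

lemma ge_of_ge (hy : IsConsensusFlow t w y) (hr : IsRegular t w δ γ₁ γ₂) {i : ℕ} {m : ℝ}
    (hm : ∀ p, m ≤ y (t i) p) {s : ℝ} (hs : t i ≤ s) (p : W) : m ≤ y s p :=
  neg_le_neg_iff.1 (hy.neg.le_of_le hr (fun p => neg_le_neg (hm p)) hs p)

/-- The gap `g_p = M - y_p` satisfies `g_p' = ∑ q, w p q * g_q - (∑ q, w p q) * g_p`; the loss rate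
is at most `card W * γ₂`, and `c` bounds the inflow from below. -/
lemma gap_dwell (hy : IsConsensusFlow t w y) (hr : IsRegular t w δ γ₁ γ₂) {i : ℕ} {M c : ℝ}
    (hc : 0 ≤ c) (hM : ∀ p, y (t i) p ≤ M) {s : ℝ} (hs : s ∈ Set.Icc (t i) (t (i + 1))) (p : W)
    (hin : ∀ x ∈ Set.Ico (t i) s, c ≤ ∑ q, w i p q * (M - y x q)) :
    Real.exp (-(Fintype.card W * γ₂) * (s - t i)) * (M - y (t i) p + c * (s - t i)) ≤
      M - y s p := by
  refine exp_mul_le_of_deriv_right (f := fun x => M - y x p)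
    (f' := fun x => -∑ q, w i p q * (y x q - y x p))
    (mul_nonneg (Nat.cast_nonneg _) hr.upper_nonneg) hc hs.1
    (continuousOn_const.sub (hy.continuousOn_dwell hr i s p)) ?_ ?_
  · intro x hx
    exact (hy.deriv i x ⟨hx.1, hx.2.trans_le hs.2⟩ p).const_sub M
  · intro x hx
    have hpos : 0 ≤ M - y x p := sub_nonneg.2 (hy.le_of_le hr hM hx.1 p)
    have h1 : -∑ q, w i p q * (y x q - y x p) =
        ∑ q, w i p q * (M - y x q) - (∑ q, w i p q) * (M - y x p) := by
      rw [Finset.sum_mul, ← Finset.sum_sub_distrib, ← Finset.sum_neg_distrib]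
      exact Finset.sum_congr rfl fun q _ => by ring
    have h2 : ∑ q, w i p q ≤ Fintype.card W * γ₂ := by
      simpa using Finset.sum_le_card_nsmul Finset.univ (fun q => w i p q) γ₂
        fun q _ => hr.le i p q
    rw [h1]
    nlinarith [hin x hx, mul_le_mul_of_nonneg_right h2 hpos]

lemma sum_gap_nonneg (hy : IsConsensusFlow t w y) (hr : IsRegular t w δ γ₁ γ₂) {i : ℕ} {M : ℝ}
    (hM : ∀ p, y (t i) p ≤ M) {s : ℝ} (hs : t i ≤ s) (j : ℕ) (p q : W) :
    0 ≤ w j p q * (M - y s q) :=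
  mul_nonneg (hr.nonneg j p q) (sub_nonneg.2 (hy.le_of_le hr hM hs q))

/-- The gap to an upper bound decays at most exponentially. -/
lemma gap_persist (hy : IsConsensusFlow t w y) (hr : IsRegular t w δ γ₁ γ₂) {i : ℕ} {M : ℝ}
    (hM : ∀ p, y (t i) p ≤ M) {s : ℝ} (hs : t i ≤ s) (p : W) :
    Real.exp (-(Fintype.card W * γ₂) * (s - t i)) * (M - y (t i) p) ≤ M - y s p := by
  have hdw : ∀ n ≥ i, ∀ s ∈ Set.Icc (t n) (t (n + 1)),
      Real.exp (-(Fintype.card W * γ₂) * (s - t n)) * (M - y (t n) p) ≤ M - y s p := by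
    intro n hn s hs
    have htn := hr.strictMono.monotone hn
    have := hy.gap_dwell hr (M := M) le_rfl (fun p => hy.le_of_le hr hM htn p) hs p
      (fun x hx => Finset.sum_nonneg fun q _ => hy.sum_gap_nonneg hr hM (htn.trans hx.1) n p q)
    simpa using this
  have hcomb : ∀ n ≥ i, ∀ s ∈ Set.Icc (t n) (t (n + 1)),
      Real.exp (-(Fintype.card W * γ₂) * (t n - t i)) * (M - y (t i) p) ≤ M - y (t n) p →
      Real.exp (-(Fintype.card W * γ₂) * (s - t i)) * (M - y (t i) p) ≤ M - y s p := by
    intro n hn s hs h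
    refine le_trans ?_ (hdw n hn s hs)
    refine le_trans (le_of_eq ?_) (mul_le_mul_of_nonneg_left h (Real.exp_pos _).le)
    rw [← mul_assoc, ← Real.exp_add]
    congr 2
    ring
  have hstep : ∀ n ≥ i,
      Real.exp (-(Fintype.card W * γ₂) * (t n - t i)) * (M - y (t i) p) ≤ M - y (t n) p := by
    intro n hn
    induction n, hn using Nat.le_induction with
    | base => simp
    | succ n hn ih => exact hcomb n hn _ (Set.right_mem_Icc.2 (hr.lt_succ n).le) ih
  obtain ⟨n, hn, hsn⟩ := hr.exists_mem_Ico hs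
  exact hcomb n hn s ⟨hsn.1, hsn.2.le⟩ (hstep n hn)

lemma gap_persist_block (hy : IsConsensusFlow t w y) (hr : IsRegular t w δ γ₁ γ₂) {i j : ℕ}
    {M η T : ℝ} (hη : 0 ≤ η) (hij : i ≤ j) (hT : t j - t i ≤ T) (hM : ∀ p, y (t i) p ≤ M) {p : W}
    (hp : y (t i) p ≤ M - η) : y (t j) p ≤ M - gapFactor (Fintype.card W) δ γ₁ γ₂ T * η := by
  have h := hy.gap_persist hr hM (hr.strictMono.monotone hij) p
  have hK : 0 ≤ Fintype.card W * γ₂ := mul_nonneg (Nat.cast_nonneg _) hr.upper_nonneg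
  have h1 : gapFactor (Fintype.card W) δ γ₁ γ₂ T ≤
      Real.exp (-(Fintype.card W * γ₂) * (t j - t i)) := by
    refine (min_le_left _ _).trans (Real.exp_le_exp.2 ?_)
    nlinarith
  have h2 := mul_le_mul h1 (show η ≤ M - y (t i) p by linarith) hη (Real.exp_pos _).le
  linarith

/-- The gap at `q` persists through dwell interval `k`, feeds `p` at rate at least `γ₁` times its
size for a time at least `δ`, and the gap thus created at `p` persists to the end of the block. -/
lemma gap_edge_block (hy : IsConsensusFlow t w y) (hr : IsRegular t w δ γ₁ γ₂) {i j k : ℕ}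
    {M η T : ℝ} (hη : 0 ≤ η) (hik : i ≤ k) (hkj : k < j) (hT : t j - t i ≤ T)
    (hM : ∀ p, y (t i) p ≤ M) {p q : W} (hq : y (t i) q ≤ M - η) (hw : w k p q ≠ 0) :
    y (t j) p ≤ M - gapFactor (Fintype.card W) δ γ₁ γ₂ T * η := by
  have hK : 0 ≤ Fintype.card W * γ₂ := mul_nonneg (Nat.cast_nonneg _) hr.upper_nonneg
  set K : ℝ := Fintype.card W * γ₂ with hKdef
  have htik := hr.strictMono.monotone hik
  have htkj := hr.strictMono.monotone (Nat.succ_le_of_lt hkj)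
  have htk := hr.lt_succ k
  have hexp : ∀ r ≤ T, Real.exp (-K * T) ≤ Real.exp (-K * r) := fun r hr' =>
    Real.exp_le_exp.2 (by nlinarith)
  have hE := Real.exp_pos (-K * T)
  have hγ := hr.lower_pos
  have hδ := hr.pos
  have hc : 0 ≤ γ₁ * (Real.exp (-K * T) * η) := by positivity
  have hdwell := hy.gap_dwell hr hc (M := M) (fun p => hy.le_of_le hr hM htik p)
    (Set.right_mem_Icc.2 htk.le) p (by
      intro x hx
      refine le_trans ?_ (Finset.single_le_sum
        (fun q _ => hy.sum_gap_nonneg hr hM (htik.trans hx.1) k p q) (Finset.mem_univ q))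
      refine mul_le_mul (hr.ge k p q hw) ?_ (by positivity) (hr.nonneg k p q)
      refine le_trans ?_ (hy.gap_persist hr hM (htik.trans hx.1) q)
      exact mul_le_mul (hexp _ (by linarith [hx.2])) (by linarith) hη (Real.exp_pos _).le)
  have hend := hy.gap_persist hr (M := M) (i := k + 1)
    (fun p => hy.le_of_le hr hM (htik.trans htk.le) p) htkj p
  rw [← hKdef] at hdwell hend
  have hgap : 0 ≤ M - y (t k) p := sub_nonneg.2 (hy.le_of_le hr hM htik p)
  have h1 : Real.exp (-K * T) * (γ₁ * (Real.exp (-K * T) * η) * δ) ≤ M - y (t (k + 1)) p := by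
    refine le_trans (mul_le_mul (hexp _ (by linarith)) ?_ (by positivity) (Real.exp_pos _).le)
      hdwell
    have := mul_le_mul_of_nonneg_left (show δ ≤ t (k + 1) - t k by linarith [hr.dwell k]) hc
    linarith
  have h2 : Real.exp (-K * T) * (Real.exp (-K * T) * (γ₁ * (Real.exp (-K * T) * η) * δ)) ≤
      M - y (t j) p :=
    le_trans (mul_le_mul (hexp _ (by linarith)) h1 (by positivity) (Real.exp_pos _).le) hend
  have h3 : gapFactor (Fintype.card W) δ γ₁ γ₂ T * η ≤
      Real.exp (-K * T) * (Real.exp (-K * T) * (γ₁ * (Real.exp (-K * T) * η) * δ)) := by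
    refine (mul_le_mul_of_nonneg_right (min_le_right _ _) hη).trans (le_of_eq ?_)
    rw [← hKdef]
    ring
  linarith

/-! ### Contraction over blocks and asymptotic bounds. -/

variable {ι : ℕ → ℕ} {T : ℝ}

/-- If in every block each proper set of vertices containing `R₀` has an active outgoing edge, then
a gap on `R₀` spreads to all vertices after as many blocks as there are vertices. -/
lemma gap_spread (hy : IsConsensusFlow t w y) (hr : IsRegular t w δ γ₁ γ₂) (hι : StrictMono ι)
    (hT : ∀ k, t (ι (k + 1)) - t (ι k) ≤ T) {R₀ : Set W}
    (hreach : ∀ k, ∀ R : Set W, R₀ ⊆ R → R ≠ Set.univ →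
      ∃ i ∈ Set.Ico (ι k) (ι (k + 1)), ∃ q ∈ R, ∃ p ∉ R, w i p q ≠ 0)
    {k : ℕ} {M η : ℝ} (hη : 0 ≤ η) (hM : ∀ p, y (t (ι k)) p ≤ M)
    (hR₀ : ∀ p ∈ R₀, y (t (ι k)) p ≤ M - η) (p : W) :
    y (t (ι (k + Fintype.card W))) p ≤
      M - gapFactor (Fintype.card W) δ γ₁ γ₂ T ^ Fintype.card W * η := by
  classical
  set κ := gapFactor (Fintype.card W) δ γ₁ γ₂ T with hκ
  have hκ0 : 0 < κ := hr.gapFactor_pos _ _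
  -- `R` collects vertices known to have a gap; it gains a vertex in each block until it is
  -- everything.
  have key : ∀ n : ℕ, ∃ R : Finset W, R₀ ⊆ R ∧ (R = Finset.univ ∨ n ≤ R.card) ∧
      ∀ p ∈ R, y (t (ι (k + n))) p ≤ M - κ ^ n * η := by
    intro n
    induction n with
    | zero =>
      exact ⟨R₀.toFinset, by simp, Or.inr (Nat.zero_le _), fun p hp => by
        simpa using hR₀ p (Set.mem_toFinset.1 hp)⟩
    | succ n ih =>
      obtain ⟨R, hR, hcard, hgap⟩ := ih
      have hM' : ∀ p, y (t (ι (k + n))) p ≤ M := fun p =>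
        hy.le_of_le hr hM (hr.strictMono.monotone (hι.monotone (Nat.le_add_right _ _))) p
      have hη' : 0 ≤ κ ^ n * η := by positivity
      have hpow : κ ^ (n + 1) * η = κ * (κ ^ n * η) := by ring
      have hpers : ∀ p ∈ R, y (t (ι (k + (n + 1)))) p ≤ M - κ ^ (n + 1) * η := fun p hp => by
        rw [hpow]
        exact hy.gap_persist_block hr hη' (hι.monotone (Nat.le_succ _)) (hT (k + n)) hM' (hgap p hp)
      by_cases huniv : R = Finset.univ
      · exact ⟨R, hR, Or.inl huniv, hpers⟩
      · obtain ⟨i, hi, q, hq, v, hv, hw⟩ := hreach (k + n) R hR (by simpa using huniv)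
        have hv' : v ∉ R := by simpa using hv
        refine ⟨insert v R, hR.trans (by simp), Or.inr ?_, ?_⟩
        · rw [Finset.card_insert_of_notMem hv']
          have := hcard.resolve_left huniv
          omega
        · intro p hp
          rcases Finset.mem_insert.1 hp with rfl | hp
          · rw [hpow]
            exact hy.gap_edge_block hr hη' hi.1 hi.2 (hT (k + n)) hM' (hgap q hq) hw
          · exact hpers p hp
  obtain ⟨R, -, hcard, hgap⟩ := key (Fintype.card W)
  have hR : R = Finset.univ := hcard.elim id fun h =>
    Finset.eq_univ_of_card _ (le_antisymm (Finset.card_le_univ _) h)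
  exact hgap p (hR ▸ Finset.mem_univ p)

lemma antitone_iSup (hy : IsConsensusFlow t w y) (hr : IsRegular t w δ γ₁ γ₂) [Nonempty W]
    (hι : StrictMono ι) : Antitone fun k => ⨆ p, y (t (ι k)) p := fun _ _ hkl =>
  ciSup_le fun p => hy.le_of_le hr (fun p => le_ciSup (Set.finite_range _).bddAbove p)
    (hr.strictMono.monotone (hι.monotone hkl)) p

lemma monotone_iInf (hy : IsConsensusFlow t w y) (hr : IsRegular t w δ γ₁ γ₂) [Nonempty W]
    (hι : StrictMono ι) : Monotone fun k => ⨅ p, y (t (ι k)) p := fun _ _ hkl =>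
  le_ciInf fun p => hy.ge_of_ge hr (fun p => ciInf_le (Set.finite_range _).bddBelow p)
    (hr.strictMono.monotone (hι.monotone hkl)) p

lemma iInf_le_iSup [Nonempty W] (k : ℕ) : ⨅ p, y (t (ι k)) p ≤ ⨆ p, y (t (ι k)) p :=
  ciInf_le_ciSup (Set.finite_range _).bddBelow (Set.finite_range _).bddAbove

lemma exists_tendsto_iSup (hy : IsConsensusFlow t w y) (hr : IsRegular t w δ γ₁ γ₂) [Nonempty W]
    (hι : StrictMono ι) : ∃ M, Tendsto (fun k => ⨆ p, y (t (ι k)) p) atTop (𝓝 M) := by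
  refine ⟨_, tendsto_atTop_ciInf (hy.antitone_iSup hr hι) ⟨⨅ p, y (t (ι 0)) p, ?_⟩⟩
  rintro _ ⟨k, rfl⟩
  exact (hy.monotone_iInf hr hι (Nat.zero_le k)).trans (iInf_le_iSup k)

lemma exists_tendsto_iInf (hy : IsConsensusFlow t w y) (hr : IsRegular t w δ γ₁ γ₂) [Nonempty W]
    (hι : StrictMono ι) : ∃ m, Tendsto (fun k => ⨅ p, y (t (ι k)) p) atTop (𝓝 m) := by
  refine ⟨_, tendsto_atTop_ciSup (hy.monotone_iInf hr hι) ⟨⨆ p, y (t (ι 0)) p, ?_⟩⟩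
  rintro _ ⟨k, rfl⟩
  exact (iInf_le_iSup k).trans (hy.antitone_iSup hr hι (Nat.zero_le k))

/-- If in every block each nonempty proper set of vertices has an active outgoing edge, all states
converge to a common value. -/
theorem exists_consensus (hy : IsConsensusFlow t w y) (hr : IsRegular t w δ γ₁ γ₂) [Nonempty W]
    (hι : StrictMono ι) (hT : ∀ k, t (ι (k + 1)) - t (ι k) ≤ T)
    (hreach : ∀ k, ∀ R : Set W, R.Nonempty → R ≠ Set.univ →
      ∃ i ∈ Set.Ico (ι k) (ι (k + 1)), ∃ q ∈ R, ∃ p ∉ R, w i p q ≠ 0) :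
    ∃ c, ∀ p, Tendsto (fun s => y s p) atTop (𝓝 c) := by
  obtain ⟨M, hM⟩ := hy.exists_tendsto_iSup hr hι
  obtain ⟨m, hm⟩ := hy.exists_tendsto_iInf hr hι
  set κ := gapFactor (Fintype.card W) δ γ₁ γ₂ T ^ Fintype.card W
  have hκ : 0 < κ := pow_pos (hr.gapFactor_pos _ _) _
  have hcontr : ∀ k, ⨆ p, y (t (ι (k + Fintype.card W))) p ≤
      (⨆ p, y (t (ι k)) p) - κ * ((⨆ p, y (t (ι k)) p) - ⨅ p, y (t (ι k)) p) := by
    intro k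
    -- A minimizer alone is the seed, with the whole spread as its gap.
    obtain ⟨r, hr'⟩ := exists_eq_ciInf_of_finite (f := fun p => y (t (ι k)) p)
    refine ciSup_le fun p => hy.gap_spread hr hι hT (R₀ := {r})
      (fun k R hR => hreach k R ⟨r, hR rfl⟩) (sub_nonneg.2 (iInf_le_iSup k))
      (fun p => le_ciSup (f := fun p => y (t (ι k)) p) (Set.finite_range _).bddAbove p) ?_ p
    rintro p rfl
    linarith
  have hMm : M = m := by
    -- In the limit `M ≤ M - κ * (M - m)`, which forces `M ≤ m`.
    have h1 := le_of_tendsto_of_tendsto' ((tendsto_add_atTop_iff_nat (Fintype.card W)).2 hM)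
      (hM.sub ((hM.sub hm).const_mul κ)) hcontr
    have h2 : m ≤ M := le_of_tendsto_of_tendsto' hm hM iInf_le_iSup
    nlinarith
  refine ⟨M, fun p => tendsto_order.2 ⟨fun a ha => ?_, fun a ha => ?_⟩⟩
  · obtain ⟨k, hk⟩ := (hm.eventually (lt_mem_nhds (hMm ▸ ha))).exists
    filter_upwards [eventually_ge_atTop (t (ι k))] with s hs
    exact hk.trans_le (hy.ge_of_ge hr
      (fun p => ciInf_le (f := fun p => y (t (ι k)) p) (Set.finite_range _).bddBelow p) hs p)
  · obtain ⟨k, hk⟩ := (hM.eventually (gt_mem_nhds ha)).exists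
    filter_upwards [eventually_ge_atTop (t (ι k))] with s hs
    exact (hy.le_of_le hr
      (fun p => le_ciSup (f := fun p => y (t (ι k)) p) (Set.finite_range _).bddAbove p)
      hs p).trans_lt hk

/-- If in every block each proper set of vertices containing `R₀` has an active outgoing edge, then
an asymptotic upper bound on `R₀` is an asymptotic upper bound on all vertices. -/
theorem eventually_le_of_reach (hy : IsConsensusFlow t w y) (hr : IsRegular t w δ γ₁ γ₂)
    (hι : StrictMono ι) (hT : ∀ k, t (ι (k + 1)) - t (ι k) ≤ T) {R₀ : Set W}
    (hreach : ∀ k, ∀ R : Set W, R₀ ⊆ R → R ≠ Set.univ →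
      ∃ i ∈ Set.Ico (ι k) (ι (k + 1)), ∃ q ∈ R, ∃ p ∉ R, w i p q ≠ 0)
    {c : ℝ} (hc : ∀ p ∈ R₀, ∀ ε > 0, ∀ᶠ s in atTop, y s p ≤ c + ε) (p : W) {ε : ℝ} (hε : 0 < ε) :
    ∀ᶠ s in atTop, y s p ≤ c + ε := by
  have : Nonempty W := ⟨p⟩
  obtain ⟨M, hM⟩ := hy.exists_tendsto_iSup hr hι
  set κ := gapFactor (Fintype.card W) δ γ₁ γ₂ T ^ Fintype.card W
  have hκ : 0 < κ := pow_pos (hr.gapFactor_pos _ _) _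
  have hMle : M ≤ c + ε / 2 := by
    -- Otherwise the gap on `R₀` below the maximum stays bounded away from zero, and the limiting
    -- maximum would drop strictly below itself.
    by_contra! hlt
    have htop : Tendsto (fun k => t (ι k)) atTop atTop := by
      refine (tendsto_atTop.2 fun b => ?_ : Tendsto t atTop atTop).comp hι.tendsto_atTop
      obtain ⟨n, -, hn⟩ := hr.exists_mem_Ico (i := 0) (s := max b 0)
        (hr.zero.le.trans (le_max_right _ _))
      filter_upwards [eventually_ge_atTop (n + 1)] with j hj
      exact (le_max_left _ _).trans (hn.2.le.trans (hr.strictMono.monotone hj))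
    have hev : ∀ᶠ s in atTop, ∀ p ∈ R₀, y s p ≤ c + ε / 2 := by
      simp only [eventually_all]
      exact fun p hp => hc p hp _ (half_pos hε)
    have hcontr : ∀ᶠ k in atTop, ⨆ p, y (t (ι (k + Fintype.card W))) p ≤
        (⨆ p, y (t (ι k)) p) - κ * ((⨆ p, y (t (ι k)) p) - (c + ε / 2)) := by
      filter_upwards [htop.eventually hev, hM.eventually (lt_mem_nhds hlt)] with k hk hk'
      refine ciSup_le fun p => hy.gap_spread hr hι hT hreach (sub_nonneg.2 hk'.le)
        (fun p => le_ciSup (f := fun p => y (t (ι k)) p) (Set.finite_range _).bddAbove p) ?_ p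
      intro p hp
      linarith [hk p hp]
    have := le_of_tendsto_of_tendsto ((tendsto_add_atTop_iff_nat (Fintype.card W)).2 hM)
      (hM.sub ((hM.sub_const (c + ε / 2)).const_mul κ)) hcontr
    nlinarith
  obtain ⟨k, hk⟩ := (hM.eventually (gt_mem_nhds (show M < c + ε by linarith))).exists
  filter_upwards [eventually_ge_atTop (t (ι k))] with s hs
  exact (hy.le_of_le hr
    (fun p => le_ciSup (f := fun p => y (t (ι k)) p) (Set.finite_range _).bddAbove p)
    hs p).trans hk.le

end IsConsensusFlow

end Flow

/-! ### Roots and paths. -/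

section Graph

variable {V : Type*}

/-- Going through `v`, the vertex `u` reaches whatever `v` does. Hence no edge enters the root set
from outside. -/
lemma mem_rootSet_of_adj {G : Digraph V} {u v : V} (h : G.Adj u v) (hv : v ∈ rootSet G) :
    u ∈ rootSet G := by
  intro z hz
  by_cases hzv : z = v
  · exact hzv ▸ Relation.TransGen.single h
  · exact Relation.TransGen.head h (hv z hzv)

/-- A path that leaves `R` does so along an edge whose head still reaches the end of the path. -/
lemma exists_edge_leaving {r : V → V → Prop} {R : Set V} {u v : V} (h : Relation.TransGen r u v)
    (hu : u ∈ R) (hv : v ∉ R) : ∃ j ∈ R, ∃ i ∉ R, r j i ∧ Relation.ReflTransGen r i v := by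
  induction h using Relation.TransGen.head_induction_on with
  | single h => exact ⟨_, hu, _, hv, h, .refl⟩
  | @head a c h hcv ih =>
    by_cases hc : c ∈ R
    · exact ih hc
    · exact ⟨_, hu, _, hc, h, hcv.to_reflTransGen⟩

lemma unionGraph_adj {A : ℝ → Matrix V V ℝ} {I : Set ℝ} {j i : V} :
    (unionGraph A I).Adj j i ↔ ∃ s ∈ I, (graph (A s)).Adj j i := by
  simp [unionGraph]

end Graph

/-! ### Signed dynamics: double cover and gauge transformation. -/

section SignedFlow

variable {V : Type*}

/-- The weights of the double cover `V × Bool`, in which a negative edge exchanges the sheets. -/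
def coverWeight (B : ℕ → V → V → ℝ) (m : ℕ) (p q : V × Bool) : ℝ :=
  if p.2 = q.2 then max (B m p.1 q.1) 0 else max (-B m p.1 q.1) 0

variable {t : ℕ → ℝ} {B : ℕ → V → V → ℝ} {δ γ₁ γ₂ T : ℝ} {ι : ℕ → ℕ}

lemma IsRegular.cover (hr : IsRegular t (fun m i j => |B m i j|) δ γ₁ γ₂) :
    IsRegular t (coverWeight B) δ γ₁ γ₂ where
  zero := hr.zero
  pos := hr.pos
  dwell := hr.dwell
  lower_pos := hr.lower_pos
  upper_nonneg := hr.upper_nonneg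
  nonneg m p q := by
    unfold coverWeight
    split_ifs <;> exact le_max_right _ _
  le m p q := by
    have := hr.le m p.1 q.1
    unfold coverWeight
    split_ifs
    · exact max_le ((le_abs_self _).trans this) hr.upper_nonneg
    · exact max_le ((neg_le_abs _).trans this) hr.upper_nonneg
  ge m p q h := by
    have hge := hr.ge m p.1 q.1
    simp only [ne_eq, abs_eq_zero] at hge
    unfold coverWeight at h ⊢
    split_ifs at h ⊢ with hpq
    · have h0 : 0 < B m p.1 q.1 := by
        by_contra! h0
        exact h (max_eq_right h0)
      have := hge h0.ne'
      rw [abs_of_pos h0] at this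
      exact this.trans (le_max_left _ _)
    · have h0 : B m p.1 q.1 < 0 := by
        by_contra! h0
        exact h (max_eq_right (by linarith))
      have := hge h0.ne
      rw [abs_of_neg h0] at this
      exact this.trans (le_max_left _ _)

lemma IsRegular.restrict (hr : IsRegular t (fun m i j => |B m i j|) δ γ₁ γ₂) (S : Set V) :
    IsRegular t (fun m (p q : S) => |B m p q|) δ γ₁ γ₂ :=
  ⟨hr.zero, hr.pos, hr.dwell, hr.lower_pos, hr.upper_nonneg, fun _ _ _ => hr.nonneg _ _ _,
    fun _ _ _ => hr.le _ _ _, fun _ _ _ => hr.ge _ _ _⟩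

variable [Fintype V] {x : ℝ → V → ℝ} {S : Set V} {σ : V → ℝ}

/-- A solution of the signed dynamics `x_i' = ∑ j, (B i j x_j - |B i j| x_i)` with weights `B m`
on `[t m, t (m + 1))`. -/
structure IsSignedFlow (t : ℕ → ℝ) (B : ℕ → V → V → ℝ) (x : ℝ → V → ℝ) : Prop where
  cont : ∀ i, ContinuousOn (fun s => x s i) (Set.Ici 0)
  deriv : ∀ m, ∀ s ∈ Set.Ico (t m) (t (m + 1)), ∀ i,
    HasDerivWithinAt (fun s => x s i) (∑ j, (B m i j * x s j - |B m i j| * x s i)) (Set.Ici s) s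

/-- With `b⁺ + b⁻ = |b|` and `b⁺ - b⁻ = b`, a repelling term `b⁻ * (-x_j - x_i)` is attraction to
the opposite sheet. -/
lemma IsSignedFlow.cover (hx : IsSignedFlow t B x) :
    IsConsensusFlow t (coverWeight B) (fun s p => if p.2 then x s p.1 else -x s p.1) where
  cont p := by
    rcases p with ⟨i, _ | _⟩
    · exact (hx.cont i).neg
    · exact hx.cont i
  deriv m s hs p := by
    have hsplit : ∀ b z : ℝ, max b 0 * z + max (-b) 0 * z = |b| * z ∧
        max b 0 * z - max (-b) 0 * z = b * z := by
      intro b z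
      rcases le_total 0 b with h | h
      · simp [h, abs_of_nonneg h]
      · simp [h, abs_of_nonpos h]
    rcases p with ⟨i, _ | _⟩
    · have := (hx.deriv m s hs i).neg
      simp only [Bool.false_eq_true, if_false]
      refine this.congr_deriv ?_
      rw [Fintype.sum_prod_type, ← Finset.sum_neg_distrib]
      refine Finset.sum_congr rfl fun j _ => ?_
      simp only [coverWeight, Fintype.sum_bool, Bool.false_eq_true, if_false, if_true]
      linear_combination (hsplit (B m i j) (x s j)).2 - (hsplit (B m i j) (x s i)).1
    · have := hx.deriv m s hs i
      simp only [if_true]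
      refine this.congr_deriv ?_
      rw [Fintype.sum_prod_type]
      refine Finset.sum_congr rfl fun j _ => ?_
      simp only [coverWeight, Fintype.sum_bool, Bool.true_eq_false, Bool.false_eq_true, if_false,
        if_true]
      linear_combination (hsplit (B m i j) (x s i)).1 - (hsplit (B m i j) (x s j)).2

/-- If `S` reaches all vertices in every block, an asymptotic bound for `|x|` on `S` holds on all
vertices. -/
theorem IsSignedFlow.eventually_abs_le (hx : IsSignedFlow t B x)
    (hr : IsRegular t (fun m i j => |B m i j|) δ γ₁ γ₂) (hι : StrictMono ι)
    (hT : ∀ k, t (ι (k + 1)) - t (ι k) ≤ T) (hS : S.Nonempty)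
    (hreach : ∀ k, ∀ r ∈ S, ∀ v, v ≠ r →
      Relation.TransGen (fun j i => ∃ m ∈ Set.Ico (ι k) (ι (k + 1)), B m i j ≠ 0) r v)
    {C : ℝ} (hC : ∀ i ∈ S, Tendsto (fun s => |x s i|) atTop (𝓝 C)) (j : V) {ε : ℝ} (hε : 0 < ε) :
    ∀ᶠ s in atTop, |x s j| ≤ C + ε := by
  have key : ∀ p : V × Bool, ∀ᶠ s in atTop, (if p.2 then x s p.1 else -x s p.1) ≤ C + ε := by
    intro p
    refine hx.cover.eventually_le_of_reach hr.cover hι hT (R₀ := {p | p.1 ∈ S}) ?_ ?_ p hε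
    · intro k R hR hne
      obtain ⟨⟨v, b⟩, hvb⟩ := (Set.ne_univ_iff_exists_notMem R).1 hne
      obtain ⟨r, hrS⟩ := hS
      have hvr : v ≠ r := by
        rintro rfl
        exact hvb (hR hrS)
      -- Use the vertices whose whole fibre lies in `R`: the tail is then available on both sheets,
      -- so an edge of either sign lifts to one entering the missing `(i, b)`.
      obtain ⟨q, hq, i, hi, ⟨m, hm, hB⟩, -⟩ := exists_edge_leaving (R := {v | ∀ b, (v, b) ∈ R})
        (hreach k r hrS v hvr) (fun b => hR hrS) (fun h => hvb (h b))
      obtain ⟨b, hb⟩ : ∃ b, (i, b) ∉ R := not_forall.1 hi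
      rcases lt_or_gt_of_ne hB with hneg | hpos
      · refine ⟨m, hm, (q, !b), hq _, (i, b), hb, ?_⟩
        simp [coverWeight, hneg]
      · refine ⟨m, hm, (q, b), hq _, (i, b), hb, ?_⟩
        simp [coverWeight, hpos]
    · rintro ⟨i, b⟩ hi ε hε
      filter_upwards [(hC i hi).eventually (gt_mem_nhds (lt_add_of_pos_right C hε))] with s hs
      have := abs_lt.1 hs
      split_ifs <;> linarith
  filter_upwards [key (j, true), key (j, false)] with s h1 h2
  simp only [if_true, Bool.false_eq_true, if_false] at h1 h2
  exact abs_le.2 ⟨by linarith, h1⟩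

/-- On a structurally balanced set without incoming edges, the gauge transformation `σ` turns the
signed dynamics into the unsigned one. -/
lemma IsSignedFlow.gauge (hx : IsSignedFlow t B x) [Fintype S]
    (hclosed : ∀ m, ∀ i ∈ S, ∀ j ∉ S, B m i j = 0) (hσ : ∀ i, σ i * σ i = 1)
    (hbal : ∀ m, ∀ i ∈ S, ∀ j ∈ S, B m i j = σ i * σ j * |B m i j|) :
    IsConsensusFlow t (fun m (p q : S) => |B m p q|) (fun s p => σ p * x s p) where
  cont p := continuousOn_const.mul (hx.cont p)
  deriv m s hs p := by
    refine ((hx.deriv m s hs p).const_mul (σ p)).congr_deriv ?_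
    classical
    rw [Finset.mul_sum, ← Finset.sum_subset (Finset.subset_univ S.toFinset),
      Finset.sum_subtype S.toFinset (p := (· ∈ S)) (by simp)]
    · refine Finset.sum_congr rfl fun q _ => ?_
      have := hbal m p p.2 q q.2
      rw [mul_sub, ← mul_assoc (σ p)]
      nth_rw 1 [this]
      linear_combination σ q * |B m p q| * x s q * hσ p
    · intro j _ hj
      simp [hclosed m p p.2 j (by simpa using hj)]

theorem IsSignedFlow.exists_gauge_limit (hx : IsSignedFlow t B x)
    (hr : IsRegular t (fun m i j => |B m i j|) δ γ₁ γ₂) (hι : StrictMono ι)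
    (hT : ∀ k, t (ι (k + 1)) - t (ι k) ≤ T) (hS : S.Nonempty)
    (hclosed : ∀ m, ∀ i ∈ S, ∀ j ∉ S, B m i j = 0) (hσ : ∀ i, σ i * σ i = 1)
    (hbal : ∀ m, ∀ i ∈ S, ∀ j ∈ S, B m i j = σ i * σ j * |B m i j|)
    (hreach : ∀ k, ∀ r ∈ S, ∀ v, v ≠ r →
      Relation.TransGen (fun j i => ∃ m ∈ Set.Ico (ι k) (ι (k + 1)), B m i j ≠ 0) r v) :
    ∃ c, ∀ i ∈ S, Tendsto (fun s => σ i * x s i) atTop (𝓝 c) := by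
  classical
  have : Nonempty S := hS.to_subtype
  obtain ⟨c, hc⟩ := (hx.gauge hclosed hσ hbal).exists_consensus (hr.restrict S) hι hT (by
    rintro k R ⟨r, hrR⟩ hne
    obtain ⟨v, hv⟩ := (Set.ne_univ_iff_exists_notMem R).1 hne
    have hvr : (v : V) ≠ r := fun h => hv (Subtype.ext h ▸ hrR)
    obtain ⟨j, ⟨q, hq, rfl⟩, i, hi, ⟨m, hm, hB⟩, hiv⟩ :=
      exists_edge_leaving (R := Subtype.val '' R) (hreach k r r.2 v hvr) ⟨r, hrR, rfl⟩
        (by rintro ⟨v', hv', h⟩; exact hv (Subtype.ext h ▸ hv'))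
    -- The path runs in the whole graph, but every vertex leading to `v ∈ S` is in `S`, which has no
    -- incoming edges.
    have hanc : ∀ i, Relation.ReflTransGen
        (fun j i => ∃ m ∈ Set.Ico (ι k) (ι (k + 1)), B m i j ≠ 0) i v → i ∈ S := by
      intro i hiv
      induction hiv using Relation.ReflTransGen.head_induction_on with
      | refl => exact v.2
      | @head a b h _ ih =>
        obtain ⟨m, -, hm⟩ := h
        by_contra ha
        exact hm (hclosed m b ih a ha)
    have hiS := hanc i hiv
    exact ⟨m, hm, q, hq, ⟨i, hiS⟩, fun h => hi ⟨_, h, rfl⟩, abs_ne_zero.2 hB⟩)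
  exact ⟨c, fun i hi => hc ⟨i, hi⟩⟩

end SignedFlow

/-- Sums of positive numbers are no smaller than the least generator. -/
lemma exists_pos_le_of_mem_closure {τ : Finset ℝ} (hτ : ∀ a ∈ τ, 0 < a) :
    ∃ δ > 0, ∀ d ∈ AddSubsemigroup.closure (τ : Set ℝ), δ ≤ d := by
  obtain ⟨δ, hδ, hle⟩ : ∃ δ > 0, ∀ a ∈ τ, δ ≤ a := by
    rcases τ.eq_empty_or_nonempty with rfl | hne
    · exact ⟨1, one_pos, by simp⟩
    · exact ⟨τ.min' hne, hτ _ (τ.min'_mem hne), fun a ha => τ.min'_le a ha⟩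
  refine ⟨δ, hδ, fun d hd => ?_⟩
  induction hd using AddSubsemigroup.closure_induction with
  | mem a ha => exact hle a ha
  | add a b _ _ ha hb => linarith

/-! ### From the network to signed flows; generic initial conditions. -/

section Network

variable {V : Type*}

/-- The gauge transformation of a bipartition: `-1` on `S` and `1` elsewhere. -/
noncomputable def gaugeSign (S : Set V) (i : V) : ℝ :=
  open Classical in if i ∈ S then -1 else 1

lemma gaugeSign_mul_self (S : Set V) (i : V) : gaugeSign S i * gaugeSign S i = 1 := by
  unfold gaugeSign
  split_ifs <;> norm_num

variable [DecidableEq V]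

/-- The matrix `A` with its diagonal replaced by zero. -/
def offDiagonal (A : Matrix V V ℝ) (i j : V) : ℝ :=
  if i = j then 0 else A i j

lemma graph_adj_iff {A : Matrix V V ℝ} {i j : V} : (graph A).Adj j i ↔ offDiagonal A i j ≠ 0 := by
  by_cases h : i = j
  · simp [graph, offDiagonal, h]
  · simp [graph, offDiagonal, h, Ne.symm h]

lemma RespectsBipartition.offDiagonal_eq {A : Matrix V V ℝ} {V₁ V₂ : Set V}
    (h : RespectsBipartition A V₁ V₂) (hdisj : Disjoint V₁ V₂) {i j : V} (hi : i ∈ V₁ ∪ V₂)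
    (hj : j ∈ V₁ ∪ V₂) :
    offDiagonal A i j = gaugeSign V₂ i * gaugeSign V₂ j * |offDiagonal A i j| := by
  by_cases h0 : offDiagonal A i j = 0
  · simp [h0]
  have hadj := graph_adj_iff.2 h0
  have hij : offDiagonal A i j = A i j := if_neg hadj.1.symm
  obtain ⟨hpos, hneg⟩ := h i j hadj
  have hnot : ∀ v ∈ V₁, v ∉ V₂ := fun v h1 h2 => Set.disjoint_left.1 hdisj h1 h2
  rw [hij]
  rcases hi with hi | hi <;> rcases hj with hj | hj
  · have := hpos (Or.inl ⟨hi, hj⟩)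
    simp [gaugeSign, hnot _ hi, hnot _ hj, abs_of_pos this]
  · have := hneg (Or.inl ⟨hi, hj⟩)
    simp [gaugeSign, hnot _ hi, hj, abs_of_neg this]
  · have := hneg (Or.inr ⟨hi, hj⟩)
    simp [gaugeSign, hi, hnot _ hj, abs_of_neg this]
  · have := hpos (Or.inr ⟨hi, hj⟩)
    simp [gaugeSign, hi, hj, abs_of_pos this]

variable [Fintype V] {A : ℝ → Matrix V V ℝ} {t : ℕ → ℝ} {x x' : ℝ → V → ℝ}

lemma neg_signedLaplacian_mulVec (A : Matrix V V ℝ) (z : V → ℝ) (i : V) :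
    (-((signedLaplacian A).mulVec z)) i =
      ∑ j, (offDiagonal A i j * z j - |offDiagonal A i j| * z i) := by
  rw [Pi.neg_apply, Matrix.mulVec, dotProduct, ← Finset.add_sum_erase _ _ (Finset.mem_univ i),
    ← Finset.add_sum_erase (a := i) Finset.univ (fun j => _ - _) (Finset.mem_univ i)]
  simp only [signedLaplacian, Matrix.of_apply, offDiagonal, if_true, abs_zero, zero_mul, sub_zero,
    zero_add, Finset.sum_sub_distrib, Finset.sum_mul, neg_add]
  rw [← Finset.sum_neg_distrib, ← Finset.sum_neg_distrib, ← Finset.sum_add_distrib,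
    ← Finset.sum_sub_distrib]
  refine Finset.sum_congr rfl fun j hj => ?_
  have : i ≠ j := (Finset.ne_of_mem_erase hj).symm
  simp only [this, if_false]
  ring

lemma IsSolution.isSignedFlow (hx : IsSolution A t x) :
    IsSignedFlow t (fun m => offDiagonal (A (t m))) x where
  cont i := (continuous_apply i).comp_continuousOn hx.1
  deriv m s hs i := by
    have h := hasDerivWithinAt_pi.1 (hx.2 m s hs) i
    rw [neg_signedLaplacian_mulVec] at h
    refine h.mono_of_mem_nhdsWithin ?_
    exact mem_of_superset (Ico_mem_nhdsGE hs.2) (Set.Ico_subset_Ico_left hs.1)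

lemma IsSolution.zero : IsSolution A t (fun _ => 0) :=
  ⟨continuousOn_const, fun _ _ _ => by simpa using hasDerivWithinAt_const _ _ _⟩

lemma IsSolution.add (hx : IsSolution A t x) (hx' : IsSolution A t x') : IsSolution A t (x + x') :=
  ⟨hx.1.add hx'.1, fun i s hs => ((hx.2 i s hs).add (hx'.2 i s hs)).congr_deriv (by
    rw [Pi.add_apply, Matrix.mulVec_add, neg_add])⟩

lemma IsSolution.const_smul (hx : IsSolution A t x) (c : ℝ) : IsSolution A t (c • x) :=
  ⟨hx.1.const_smul c, fun i s hs => ((hx.2 i s hs).const_smul c).congr_deriv (by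
    rw [Pi.smul_apply, Matrix.mulVec_smul, smul_neg])⟩

/-- The initial conditions that admit a solution tending to zero on `S`. -/
def vanishingSubmodule (A : ℝ → Matrix V V ℝ) (t : ℕ → ℝ) (S : Set V) : Submodule ℝ (V → ℝ) where
  carrier := {x₀ | ∃ x, IsSolution A t x ∧ x 0 = x₀ ∧
    ∀ i ∈ S, Tendsto (fun s => x s i) atTop (𝓝 0)}
  zero_mem' := ⟨_, IsSolution.zero, rfl, fun _ _ => tendsto_const_nhds⟩
  add_mem' := by
    rintro _ _ ⟨x, hx, rfl, h⟩ ⟨x', hx', rfl, h'⟩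
    exact ⟨_, hx.add hx', rfl, fun i hi => by simpa using (h i hi).add (h' i hi)⟩
  smul_mem' := by
    rintro c _ ⟨x, hx, rfl, h⟩
    exact ⟨_, hx.const_smul c, rfl, fun i hi => by simpa using (h i hi).const_mul c⟩

variable {ι : ℕ → ℕ} {T δ γ₁ γ₂ : ℝ} {S : Set V} {σ : V → ℝ}

/-- From the initial state `σ` the gauged states start at `1` on `S`, and the minimum principle
keeps them at least `1`. -/
lemma vanishingSubmodule_ne_top (hr : IsRegular t (fun m i j => |offDiagonal (A (t m)) i j|) δ γ₁ γ₂)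
    (hS : S.Nonempty) (hclosed : ∀ m, ∀ i ∈ S, ∀ j ∉ S, offDiagonal (A (t m)) i j = 0)
    (hσ : ∀ i, σ i * σ i = 1) (hbal : ∀ m, ∀ i ∈ S, ∀ j ∈ S,
      offDiagonal (A (t m)) i j = σ i * σ j * |offDiagonal (A (t m)) i j|) :
    vanishingSubmodule A t S ≠ ⊤ := by
  classical
  intro htop
  obtain ⟨x, hx, hx0, hlim⟩ : σ ∈ vanishingSubmodule A t S := htop ▸ Submodule.mem_top
  obtain ⟨i, hi⟩ := hS
  have hge : ∀ᶠ s in atTop, 1 ≤ σ i * x s i := by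
    filter_upwards [eventually_ge_atTop (t 0)] with s hs
    refine (hx.isSignedFlow.gauge hclosed hσ hbal).ge_of_ge (hr.restrict S) (i := 0) ?_ hs ⟨i, hi⟩
    intro p
    rw [hr.zero, hx0, hσ]
  have := ge_of_tendsto ((hlim i hi).const_mul (σ i)) hge
  norm_num at this

theorem polarizesOn_of_gauge (hr : IsRegular t (fun m i j => |offDiagonal (A (t m)) i j|) δ γ₁ γ₂)
    (hι : StrictMono ι) (hT : ∀ k, t (ι (k + 1)) - t (ι k) ≤ T)
    (hclosed : ∀ m, ∀ i ∈ S, ∀ j ∉ S, offDiagonal (A (t m)) i j = 0)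
    (hσ : ∀ i, σ i * σ i = 1) (hbal : ∀ m, ∀ i ∈ S, ∀ j ∈ S,
      offDiagonal (A (t m)) i j = σ i * σ j * |offDiagonal (A (t m)) i j|)
    (hreach : ∀ k, ∀ r ∈ S, ∀ v, v ≠ r → Relation.TransGen
      (fun j i => ∃ m ∈ Set.Ico (ι k) (ι (k + 1)), offDiagonal (A (t m)) i j ≠ 0) r v)
    {a b : V} (ha : a ∈ S) (hb : b ∈ S) (hab : σ a = -σ b) : PolarizesOn A t S := by
  have hnull : ∀ᵐ x₀ : V → ℝ, x₀ ∉ vanishingSubmodule A t S :=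
    measure_eq_zero_iff_ae_notMem.1 (Measure.addHaar_submodule volume _
      (vanishingSubmodule_ne_top hr ⟨a, ha⟩ hclosed hσ hbal))
  filter_upwards [hnull] with x₀ hx₀ x hx hxx
  obtain ⟨c, hc⟩ :=
    hx.isSignedFlow.exists_gauge_limit hr hι hT ⟨a, ha⟩ hclosed hσ hbal hreach
  have hlim : ∀ i ∈ S, Tendsto (fun s => x s i) atTop (𝓝 (σ i * c)) := fun i hi => by
    simpa [← mul_assoc, hσ] using (hc i hi).const_mul (σ i)
  have hc0 : c ≠ 0 := by
    rintro rfl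
    exact hx₀ ⟨x, hx, hxx, fun i hi => by simpa using hlim i hi⟩
  have habs : ∀ i, |σ i * c| = |c| := fun i => by
    rw [abs_mul, show |σ i| = 1 by
      rcases mul_self_eq_one_iff.1 (hσ i) with h | h <;> simp [h], one_mul]
  refine ⟨fun i => σ i * c, hlim, fun i _ j _ => ⟨?_, ?_⟩, a, ha, b, hb, ?_, ?_⟩
  · rw [habs, habs]
  · rw [habs]
    exact abs_pos.2 hc0
  · rintro rfl
    have h0 : σ a = 0 := by linarith
    simpa [h0] using hσ a
  · simp only [hab]
    ring

end Network

end SignedNetwork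

/-! ### The main theorem. -/

open SignedNetwork Filter Topology in
theorem theorem8 (N : ℕ) (A : ℝ → Matrix (Fin N) (Fin N) ℝ) (t : ℕ → ℝ)
    -- dwell times lie in the additive semigroup generated by a finite set of positive numbers
    (τ : Finset ℝ) (hτ : ∀ a ∈ τ, 0 < a)
    (ht0 : t 0 = 0)
    (hdwell : ∀ i, t (i + 1) - t i ∈ AddSubsemigroup.closure (τ : Set ℝ))
    -- the weights are piecewise constant
    (hconst : ∀ i, ∀ s ∈ Set.Ico (t i) (t (i + 1)), A s = A (t i))
    -- the magnitudes of the nonzero weights lie in `[γ₁, γ₂]`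
    (γ₁ γ₂ : ℝ) (hγ₁ : 0 < γ₁) (hγ₂ : 0 < γ₂)
    (hweight : ∀ i, ∀ j k, j ≠ k → A (t i) j k ≠ 0 → |A (t i) j k| ∈ Set.Icc γ₁ γ₂)
    -- the common root vertex set and its bipartition
    (Vs V₁ V₂ : Set (Fin N))
    (hVs : rootSet (unionGraph A (Set.Ici 0)) = Vs)
    (hunion : V₁ ∪ V₂ = Vs) (hdisj : Disjoint V₁ V₂)
    (hV₁ : V₁.Nonempty) (hV₂ : V₂.Nonempty)
    (hbal : ∀ s : ℝ, 0 ≤ s → RespectsBipartition (A s) V₁ V₂)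
    -- the intervals `[t (ι k), t (ι (k + 1)))`
    (ι : ℕ → ℕ) (hι0 : ι 0 = 0) (hι : StrictMono ι)
    (hbdd : ∃ T : ℝ, ∀ k, t (ι (k + 1)) - t (ι k) ≤ T)
    (htree : ∀ k, ContainsSpanningTree (unionGraph A (Set.Ico (t (ι k)) (t (ι (k + 1))))))
    (hroot : ∀ k, rootSet (unionGraph A (Set.Ico (t (ι k)) (t (ι (k + 1))))) = Vs) :
    PolarizesOn A t Vs ∧
      ∀ x : ℝ → Fin N → ℝ, IsSolution A t x →
        ∃ C : ℝ, 0 ≤ C ∧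
          (∀ i ∈ Vs, Tendsto (fun s => |x s i|) atTop (𝓝 C)) ∧
          ∀ j ∉ Vs, ∀ ε > 0, ∀ᶠ s in atTop, x s j ∈ Set.Icc (-(C + ε)) (C + ε) := by
  obtain ⟨δ, hδ, hδle⟩ := exists_pos_le_of_mem_closure hτ
  obtain ⟨T, hT⟩ := hbdd
  have hne : ∀ m i j, offDiagonal (A (t m)) i j ≠ 0 →
      |offDiagonal (A (t m)) i j| ∈ Set.Icc γ₁ γ₂ := by
    intro m i j h
    have hadj := graph_adj_iff.2 h
    have := hweight m i j hadj.1.symm hadj.2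
    rwa [offDiagonal, if_neg hadj.1.symm]
  have hr : IsRegular t (fun m i j => |offDiagonal (A (t m)) i j|) δ γ₁ γ₂ :=
    { zero := ht0
      pos := hδ
      dwell := fun i => by linarith [hδle _ (hdwell i)]
      lower_pos := hγ₁
      upper_nonneg := hγ₂.le
      nonneg := fun _ _ _ => abs_nonneg _
      le := fun m i j => by
        by_cases h : offDiagonal (A (t m)) i j = 0
        · simpa [h] using hγ₂.le
        · exact (hne m i j h).2
      ge := fun m i j h => (hne m i j (abs_ne_zero.1 h)).1 }
  have hclosed : ∀ m, ∀ i ∈ Vs, ∀ j ∉ Vs, offDiagonal (A (t m)) i j = 0 := by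
    intro m i hi j hj
    by_contra h
    rw [← hVs] at hi hj
    exact hj (mem_rootSet_of_adj
      (unionGraph_adj.2 ⟨t m, hr.time_nonneg m, graph_adj_iff.2 h⟩) hi)
  have hbal' : ∀ m, ∀ i ∈ Vs, ∀ j ∈ Vs, offDiagonal (A (t m)) i j =
      gaugeSign V₂ i * gaugeSign V₂ j * |offDiagonal (A (t m)) i j| := by
    intro m i hi j hj
    rw [← hunion] at hi hj
    exact (hbal (t m) (hr.time_nonneg m)).offDiagonal_eq hdisj hi hj
  have hreach : ∀ k, ∀ r ∈ Vs, ∀ v, v ≠ r → Relation.TransGen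
      (fun j i => ∃ m ∈ Set.Ico (ι k) (ι (k + 1)), offDiagonal (A (t m)) i j ≠ 0) r v := by
    intro k r hrV v hv
    rw [← hroot k] at hrV
    refine Relation.TransGen.mono (fun j i hji => ?_) r v (hrV v hv)
    obtain ⟨s, hs, hadj⟩ := unionGraph_adj.1 hji
    -- An edge seen at a time in the block is present throughout the dwell interval containing that
    -- time, whose index lies in the block's range.
    obtain ⟨m, hm, hsm⟩ := hr.exists_mem_Ico hs.1
    refine ⟨m, ⟨hm, hr.strictMono.lt_iff_lt.1 (hsm.1.trans_lt hs.2)⟩, ?_⟩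
    rw [← hconst m s hsm]
    exact graph_adj_iff.1 hadj
  obtain ⟨a, ha⟩ := hV₁
  obtain ⟨b, hb⟩ := hV₂
  have haV : a ∈ Vs := hunion ▸ Or.inl ha
  have hbV : b ∈ Vs := hunion ▸ Or.inr hb
  have hσ := gaugeSign_mul_self V₂
  refine ⟨polarizesOn_of_gauge hr hι hT hclosed hσ hbal' hreach haV hbV ?_, fun x hx => ?_⟩
  · simp [gaugeSign, hb, Set.disjoint_left.1 hdisj ha]
  obtain ⟨c, hc⟩ :=
    hx.isSignedFlow.exists_gauge_limit hr hι hT ⟨a, haV⟩ hclosed hσ hbal' hreach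
  have habs : ∀ i ∈ Vs, Tendsto (fun s => |x s i|) atTop (𝓝 |c|) := by
    intro i hi
    refine (hc i hi).abs.congr fun s => ?_
    rw [abs_mul]
    rcases mul_self_eq_one_iff.1 (hσ i) with h | h <;> simp [h]
  refine ⟨|c|, abs_nonneg c, habs, fun j _ ε hε => ?_⟩
  filter_upwards [hx.isSignedFlow.eventually_abs_le hr hι hT ⟨a, haV⟩ hreach habs j hε] with s hs
  exact abs_le.1 hs
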